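/- Let $n,d\ge 1$, let $A_1,\dots,A_d$ be real symmetric positive semidefinite $n\times n$ matrices, and let $\langle A,B\rangle=\operatorname{Tr}(A^TB)$ and $\mathcal S=\{X\succeq 0:\operatorname{Tr}X=1\}$. Consider the problem $\min_{X\in\mathcal S} f(\mathcal B(X))$ with $\mathcal B(X)=(\langle A_i,X\rangle)_{i=1}^d$ and $f(w)=-\sum_{i=1}^d\log w_i$; here $f$ is $\theta$-logarithmically homogeneous with $\theta=d$, and $X$ is called feasible if $X\in\mathcal S$ and $\langle A_i,X\rangle>0$ for all $i$. For feasible $X$ write $D_X=\mathcal B^*(\nabla f(\mathcal B(X)))$ and $F^{\rm lin}_X(H)=\langle D_X,H\rangle$ for $H\in\mathcal S$. A randomized oracle is a *PLMO with failure probability $p$* if, for every feasible $X$ and every $\delta>0$, on the input $(D_X,\delta,X)$ it always returns a pair $(H,G)$ with $H\in\mathcal S$ and $G=F^{\rm lin}_X(X)-F^{\rm lin}_X(H)\ge 0$, and with probability at least $1-p$ at least one of the following holds: - (large gap) $G>\theta$; - ($\delta$-suboptimality) $F^{\rm lin}_X(H)\le F^{\rm lin}_X(H^\star)+\delta$, where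 $H^\star$ minimizes $F^{\rm lin}_X$ over $\mathcal S$. Let $c>2$ and $p\in(0,1]$. Consider the following algorithm with input $(D_X,\delta,X)$. 1. Set $J=-D_X$. 2. Run the Lanczos method for the largest eigenvalue of $J$, from a starting vector $b$ distributed uniformly on the unit sphere of $\mathbb R^n$, for $$N=\left\lceil\frac12+\sqrt{\frac{c\,\theta}{8\min\{\delta,(c-2)\theta\}}}\;\log\frac{4n}{p^2}\right\rceil$$ iterations (fewer if the Lanczos recurrence ends early with a zero residual). Its output is the unit vector $u=\sum_i y_iq_i$, where $q_1=b,q_2,\dots$ are the Lanczos vectors and $y$ is a unit eigenvector for the largest eigenvalue of the tridiagonal matrix that the method produces. 3. Set $H=uu^T$ and $G=F^{\rm lin}_X(X)-F^{\rm lin}_X(H)$. 4. If $G<0$, set $H=X$ and $G=0$. Return $(H,G)$. Then the algorithm is well defined (it has an output for every feasible $X$, every $\delta>0$ and every starting vector $b$), and it is a PLMO with failure probability $p$, whichever unit eigenvector $y$ is chosen in step 2. -/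

import Mathlib

open MeasureTheory

noncomputable section

namespace GMean

/-! ### The problem `min_{X ∈ S} - ∑ i, log ⟨A i, X⟩` -/

/-- The matrix inner product `⟨A, B⟩ = Tr (Aᵀ B)`. -/
def minner {n : ℕ} (A B : Matrix (Fin n) (Fin n) ℝ) : ℝ := (A.transpose * B).trace

/-- The spectraplex `S = {X ⪰ 0 : Tr X = 1}`, i.e. the domain of the indicator function `g`. -/
def spectraplex (n : ℕ) : Set (Matrix (Fin n) (Fin n) ℝ) :=
  {X | X.PosSemidef ∧ X.trace = 1}

/-- The linear map `𝓑(X) = (⟨A i, X⟩)_i`. -/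
def opB {n d : ℕ} (A : Fin d → Matrix (Fin n) (Fin n) ℝ) (X : Matrix (Fin n) (Fin n) ℝ) :
    EuclideanSpace ℝ (Fin d) :=
  WithLp.toLp 2 fun i => minner (A i) X

/-- The adjoint map `𝓑⋆(y) = ∑ i, y i • A i`; see `minner_opBAdj`. -/
def opBAdj {n d : ℕ} (A : Fin d → Matrix (Fin n) (Fin n) ℝ) (y : EuclideanSpace ℝ (Fin d)) :
    Matrix (Fin n) (Fin n) ℝ :=
  ∑ i, y i • A i

theorem minner_opBAdj {n d : ℕ} (A : Fin d → Matrix (Fin n) (Fin n) ℝ)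
    (y : EuclideanSpace ℝ (Fin d)) (X : Matrix (Fin n) (Fin n) ℝ) :
    minner (opBAdj A y) X = inner ℝ y (opB A X) := by
  simp [minner, opBAdj, opB, PiLp.inner_apply, Matrix.transpose_sum, Matrix.sum_mul,
    Matrix.trace_sum, mul_comm]

/-- The barrier `f(w) = - ∑ i, log (w i)` of the positive orthant. It is logarithmically
homogeneous with parameter `θ = d`. -/
def barrier (d : ℕ) (w : EuclideanSpace ℝ (Fin d)) : ℝ := -∑ i, Real.log (w i)

/-- The feasible points of the problem: the `X ∈ S` at which every logarithm is defined. -/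
def feasible {n d : ℕ} (A : Fin d → Matrix (Fin n) (Fin n) ℝ) :
    Set (Matrix (Fin n) (Fin n) ℝ) :=
  {X | X ∈ spectraplex n ∧ ∀ i, 0 < minner (A i) X}

/-- The gradient `𝓑⋆(∇f(𝓑(X)))` of the smooth part of the objective. -/
def grad {n d : ℕ} (A : Fin d → Matrix (Fin n) (Fin n) ℝ) (X : Matrix (Fin n) (Fin n) ℝ) :
    Matrix (Fin n) (Fin n) ℝ :=
  opBAdj A (gradient (barrier d) (opB A X))

/-- The objective `H ↦ ⟨𝓑⋆(∇f(𝓑(X))), H⟩` of the linearized subproblem, which is minimized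
over `H ∈ S`. (The indicator function `g` vanishes on `S`.) -/
def linObj {n d : ℕ} (A : Fin d → Matrix (Fin n) (Fin n) ℝ) (X H : Matrix (Fin n) (Fin n) ℝ) :
    ℝ :=
  minner (grad A X) H

/-! ### The probabilistic linear minimization oracle -/

/-- Large gap condition: `G > θ + R_g`. -/
def LargeGap (θ Rg G : ℝ) : Prop := θ + Rg < G

/-- `δ`-suboptimality: `H ∈ S` is a `δ`-optimal point of the linearized subproblem at `X`,
`Hs` being an optimal point of it. -/
def IsSubopt {n d : ℕ} (A : Fin d → Matrix (Fin n) (Fin n) ℝ)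
    (X : Matrix (Fin n) (Fin n) ℝ) (δ : ℝ) (H : Matrix (Fin n) (Fin n) ℝ) : Prop :=
  H ∈ spectraplex n ∧ ∃ Hs ∈ spectraplex n,
    (∀ K ∈ spectraplex n, linObj A X Hs ≤ linObj A X K) ∧ linObj A X H ≤ linObj A X Hs + δ

/-- `O` takes a gradient, a tolerance, the current point and a random outcome `ω`, and returns a
pair `(H, G)`. It is a `PLMO` with failure probability `p` if for every feasible `X` and every
`δ > 0` the returned pair always consists of a point `H ∈ S` and its approximate duality gap
`G = F_lin(X) - F_lin(H) ≥ 0`, and, except on an event of probability at most `p`, it satisfies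
the large gap condition (here `θ = d` and `R_g = 0`) or `δ`-suboptimality.
(On a set that is not measurable `μ` is the outer measure, so the bound provides a measurable
event of probability at least `1 - p` on which one of the two conditions holds.) -/
def IsPLMO {n d : ℕ} (A : Fin d → Matrix (Fin n) (Fin n) ℝ) (p : ℝ)
    {Ω : Type} [MeasurableSpace Ω] (μ : Measure Ω)
    (O : Matrix (Fin n) (Fin n) ℝ → ℝ → Matrix (Fin n) (Fin n) ℝ → Ω →
      Matrix (Fin n) (Fin n) ℝ × ℝ) : Prop :=
  IsProbabilityMeasure μ ∧
  ∀ X ∈ feasible A, ∀ δ : ℝ, 0 < δ →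
    (∀ ω, (O (grad A X) δ X ω).1 ∈ spectraplex n ∧
      (O (grad A X) δ X ω).2 = linObj A X X - linObj A X (O (grad A X) δ X ω).1 ∧
      0 ≤ (O (grad A X) δ X ω).2) ∧
    μ {ω | ¬ (LargeGap d 0 (O (grad A X) δ X ω).2 ∨ IsSubopt A X δ (O (grad A X) δ X ω).1)}
      ≤ ENNReal.ofReal p

/-! ### The Lanczos method -/

/-- The data kept by the Lanczos recurrence: the previous and the current Lanczos vector, and the
coefficient `β` that links them. -/
structure LanczosState (n : ℕ) where
  prev : EuclideanSpace ℝ (Fin n)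
  cur : EuclideanSpace ℝ (Fin n)
  beta : ℝ

/-- The residual `w = J q - β q' - ⟨q, J q⟩ q` computed in one Lanczos iteration. -/
def LanczosState.residual {n : ℕ} (J : Matrix (Fin n) (Fin n) ℝ) (s : LanczosState n) :
    EuclideanSpace ℝ (Fin n) :=
  Matrix.toEuclideanLin J s.cur - s.beta • s.prev
    - (inner ℝ s.cur (Matrix.toEuclideanLin J s.cur) : ℝ) • s.cur

/-- The three-term Lanczos recurrence from the unit vector `b`. It is meant to be used only up to
the first vanishing residual, where the method stops. -/
def lanczosState {n : ℕ} (J : Matrix (Fin n) (Fin n) ℝ) (b : EuclideanSpace ℝ (Fin n)) :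
    ℕ → LanczosState n
  | 0 => ⟨0, b, 0⟩
  | k + 1 =>
    ⟨(lanczosState J b k).cur,
      ‖(lanczosState J b k).residual J‖⁻¹ • (lanczosState J b k).residual J,
      ‖(lanczosState J b k).residual J‖⟩

/-- The Lanczos vectors `q 0 = b, q 1, q 2, …`. -/
def lanczosVec {n : ℕ} (J : Matrix (Fin n) (Fin n) ℝ) (b : EuclideanSpace ℝ (Fin n)) (k : ℕ) :
    EuclideanSpace ℝ (Fin n) :=
  (lanczosState J b k).cur

/-- The diagonal coefficients `α k = ⟨q k, J q k⟩`. -/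
def lanczosAlpha {n : ℕ} (J : Matrix (Fin n) (Fin n) ℝ) (b : EuclideanSpace ℝ (Fin n)) (k : ℕ) :
    ℝ :=
  inner ℝ (lanczosVec J b k) (Matrix.toEuclideanLin J (lanczosVec J b k))

/-- The off-diagonal coefficients: `β k` is the norm of the residual of iteration `k`. -/
def lanczosBeta {n : ℕ} (J : Matrix (Fin n) (Fin n) ℝ) (b : EuclideanSpace ℝ (Fin n)) (k : ℕ) :
    ℝ :=
  ‖(lanczosState J b k).residual J‖

/-- The tridiagonal matrix produced by the first `m` iterations. -/
def lanczosT {n : ℕ} (J : Matrix (Fin n) (Fin n) ℝ) (b : EuclideanSpace ℝ (Fin n)) (m : ℕ) :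
    Matrix (Fin m) (Fin m) ℝ :=
  Matrix.of fun i j =>
    if i = j then lanczosAlpha J b i
    else if (i : ℕ) + 1 = j then lanczosBeta J b i
    else if (j : ℕ) + 1 = i then lanczosBeta J b j
    else 0

/-- The number of iterations that are performed within a budget of `N` is `m`: either the budget is
used up, or the method stops at the first vanishing residual. -/
def LanczosRuns {n : ℕ} (J : Matrix (Fin n) (Fin n) ℝ) (b : EuclideanSpace ℝ (Fin n))
    (N m : ℕ) : Prop :=
  1 ≤ m ∧ m ≤ N ∧ (∀ j, j + 1 < m → lanczosBeta J b j ≠ 0) ∧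
    (m = N ∨ lanczosBeta J b (m - 1) = 0)

/-- `u` is the output of the Lanczos method for the largest eigenvalue of `J`, started at `b` and
run for (at most) `N` iterations: the Ritz vector `u = ∑ i, y i • q i`, where `y` is a unit
eigenvector of the tridiagonal matrix for its largest eigenvalue. -/
def IsLanczosOutput {n : ℕ} (J : Matrix (Fin n) (Fin n) ℝ) (b : EuclideanSpace ℝ (Fin n))
    (N : ℕ) (u : EuclideanSpace ℝ (Fin n)) : Prop :=
  ∃ m, LanczosRuns J b N m ∧ ∃ (y : EuclideanSpace ℝ (Fin m)) (lam : ℝ),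
    ‖y‖ = 1 ∧ Matrix.toEuclideanLin (lanczosT J b m) y = lam • y ∧
    (∀ ν : ℝ, Module.End.HasEigenvalue (Matrix.toEuclideanLin (lanczosT J b m)) ν → ν ≤ lam) ∧
    u = ∑ i, y i • lanczosVec J b i

/-- The uniform probability distribution on the unit sphere of `ℝⁿ`. -/
def uniformSphere (n : ℕ) : Measure (Metric.sphere (0 : EuclideanSpace ℝ (Fin n)) 1) :=
  ((volume : Measure (EuclideanSpace ℝ (Fin n))).toSphere Set.univ)⁻¹ •
    (volume : Measure (EuclideanSpace ℝ (Fin n))).toSphere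

/-! ### The algorithm -/

/-- The number of Lanczos iterations
`1/2 + √(c θ / (8 min {δ, (c - 2) θ})) * log (4 n / p²)`, rounded up to an integer. -/
def numIter (n : ℕ) (θ c δ p : ℝ) : ℕ :=
  ⌈1 / 2 + √(c * θ / (8 * min δ ((c - 2) * θ))) * Real.log (4 * n / p ^ 2)⌉₊

/-- `out = (H, G)` is the output of the algorithm on the gradient `D`, the tolerance `δ` and the
current point `X`, when the Lanczos method for `J = -D` is started at `b`:
`H = u uᵀ` and `G = ⟨D, X⟩ - ⟨D, H⟩`, replaced by `(X, 0)` if `G < 0`. -/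
def IsAlgOutput {n : ℕ} (θ c p : ℝ) (D : Matrix (Fin n) (Fin n) ℝ) (δ : ℝ)
    (X : Matrix (Fin n) (Fin n) ℝ) (b : EuclideanSpace ℝ (Fin n))
    (out : Matrix (Fin n) (Fin n) ℝ × ℝ) : Prop :=
  ∃ u : EuclideanSpace ℝ (Fin n), IsLanczosOutput (-D) b (numIter n θ c δ p) u ∧
    out =
      if minner D X - minner D (Matrix.vecMulVec u u) < 0 then (X, 0)
      else (Matrix.vecMulVec u u, minner D X - minner D (Matrix.vecMulVec u u))

/-- `O` is a realization of the algorithm for the problem with data `A` (so `θ = d`), its source of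
randomness being the starting point of the Lanczos method. -/
def Realizes {n d : ℕ} (A : Fin d → Matrix (Fin n) (Fin n) ℝ) (c p : ℝ)
    (O : Matrix (Fin n) (Fin n) ℝ → ℝ → Matrix (Fin n) (Fin n) ℝ →
      Metric.sphere (0 : EuclideanSpace ℝ (Fin n)) 1 → Matrix (Fin n) (Fin n) ℝ × ℝ) : Prop :=
  ∀ X ∈ feasible A, ∀ δ : ℝ, 0 < δ →
    ∀ b : Metric.sphere (0 : EuclideanSpace ℝ (Fin n)) 1,
    IsAlgOutput (d : ℝ) c p (grad A X) δ X (b : EuclideanSpace ℝ (Fin n)) (O (grad A X) δ X b)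

end GMean

end

noncomputable section

namespace GMean

/-! ### Rayleigh quotients of symmetric operators -/

section Rayleigh

variable {n : ℕ} {T : EuclideanSpace ℝ (Fin n) →ₗ[ℝ] EuclideanSpace ℝ (Fin n)}

/-! Write `J = -D_X`, which is positive semidefinite, let `λ` be its largest eigenvalue, and let `ξ
= ⟨u, J u⟩` be the Ritz value. Over the spectraplex the linear objective has minimum `-λ`, and `u
uᵀ` attains `-ξ`. Logarithmic homogeneity gives `⟨D_X, X⟩ = -θ`, so `λ ≥ θ` and the gap before
truncation is `ξ - θ`.

It suffices that `ξ > (1 - ε) λ` with `ε = min {δ, (c - 2) θ} / (c θ)`. If `λ ≤ c θ`, the error `ε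
λ` is at most `δ`. If `λ > c θ`, then `ξ > (1 - ε) c θ ≥ 2 θ`, so the gap exceeds `θ`. A relative
accuracy thus serves both alternatives, however large `λ` is.

The relative accuracy follows from a Chebyshev argument. `ξ` maximizes the Rayleigh quotient over
the Krylov space (`IsLanczosOutput.inner_aeval_le`). Testing it with a polynomial that stays small,
in the weight `1 - s`, on the rescaled lower spectrum and is huge at `λ` shows that failure forces
the component of `b` along a top eigenvector to be at most `2 exp (-(2N - 1) √ε)`
(`abs_repr_le_of_krylov`). The choice of `N` makes this at most `p / √n`.

Such a small component has probability at most `p` (`uniformSphere_abs_repr_le`). The uniform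
measure of a set of directions is the Gaussian measure of the cone over it, and for a Gaussian
vector one conditions on the other coordinates. -/

theorem inner_self_apply_eq_sum (hT : T.IsSymmetric) (z : EuclideanSpace ℝ (Fin n)) :
    inner ℝ z (T z) = ∑ i, hT.eigenvalues finrank_euclideanSpace_fin i *
      (hT.eigenvectorBasis finrank_euclideanSpace_fin).repr z i ^ 2 := by
  rw [← (hT.eigenvectorBasis finrank_euclideanSpace_fin).repr.inner_map_map, PiLp.inner_apply]
  refine Finset.sum_congr rfl fun i _ => ?_
  rw [hT.eigenvectorBasis_apply_self_apply]
  simp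
  ring

theorem norm_sq_eq_sum_repr (b : OrthonormalBasis (Fin n) ℝ (EuclideanSpace ℝ (Fin n)))
    (z : EuclideanSpace ℝ (Fin n)) : ‖z‖ ^ 2 = ∑ i, b.repr z i ^ 2 := by
  rw [← b.repr.norm_map, EuclideanSpace.norm_sq_eq]
  simp

theorem inner_self_apply_le (hT : T.IsSymmetric) {lam : ℝ}
    (h : ∀ ν : ℝ, Module.End.HasEigenvalue T ν → ν ≤ lam) (z : EuclideanSpace ℝ (Fin n)) :
    inner ℝ z (T z) ≤ lam * ‖z‖ ^ 2 := by
  rw [inner_self_apply_eq_sum hT,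
    norm_sq_eq_sum_repr (hT.eigenvectorBasis finrank_euclideanSpace_fin), Finset.mul_sum]
  gcongr with i
  exact h _ (hT.hasEigenvalue_eigenvalues _ i)

end Rayleigh

/-! ### The Lanczos recurrence -/

section Lanczos

variable {n : ℕ} (J : Matrix (Fin n) (Fin n) ℝ) (b : EuclideanSpace ℝ (Fin n))

/-- No case distinction is needed later: when the residual vanishes, both sides are zero. -/
theorem residual_eq (k : ℕ) :
    (lanczosState J b k).residual J = lanczosBeta J b k • lanczosVec J b (k + 1) := by
  by_cases h : (lanczosState J b k).residual J = 0
  · simp [lanczosBeta, h]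
  · have : ‖(lanczosState J b k).residual J‖ ≠ 0 := norm_ne_zero_iff.2 h
    simp [lanczosBeta, lanczosVec, lanczosState, smul_smul, this]

theorem apply_lanczosVec_zero :
    Matrix.toEuclideanLin J (lanczosVec J b 0) =
      lanczosAlpha J b 0 • lanczosVec J b 0 + lanczosBeta J b 0 • lanczosVec J b 1 := by
  have h := residual_eq J b 0
  rw [← h]
  simp [LanczosState.residual, lanczosState, lanczosAlpha, lanczosVec]

theorem apply_lanczosVec_succ (k : ℕ) :
    Matrix.toEuclideanLin J (lanczosVec J b (k + 1)) =
      lanczosBeta J b k • lanczosVec J b k + lanczosAlpha J b (k + 1) • lanczosVec J b (k + 1) +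
        lanczosBeta J b (k + 1) • lanczosVec J b (k + 2) := by
  rw [← residual_eq J b (k + 1)]
  have h1 : (lanczosState J b (k + 1)).beta = lanczosBeta J b k := rfl
  have h2 : (lanczosState J b (k + 1)).prev = lanczosVec J b k := rfl
  have h3 : (lanczosState J b (k + 1)).cur = lanczosVec J b (k + 1) := rfl
  rw [LanczosState.residual, h1, h2, h3, lanczosAlpha]
  abel

variable {J b}

theorem norm_lanczosVec_succ {k : ℕ} (h : lanczosBeta J b k ≠ 0) :
    ‖lanczosVec J b (k + 1)‖ = 1 := by
  have : ‖(lanczosState J b k).residual J‖ ≠ 0 := h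
  simp [lanczosVec, lanczosState, norm_smul, this]

/-- Three-term recurrences keep orthogonality because `J` is symmetric: `J q i` involves only `q
(i-1)`, `q i`, `q (i+1)`, so `q (k+1)` has to be checked only against `q k`, where `α k` cancels,
and `q (k-1)`, where `β (k-1)` cancels. -/
theorem inner_lanczosVec (hJ : J.IsHermitian) (hb : ‖b‖ = 1) (k : ℕ)
    (h : ∀ j < k, lanczosBeta J b j ≠ 0) :
    ∀ i ≤ k, ∀ j ≤ k, inner ℝ (lanczosVec J b i) (lanczosVec J b j) = if i = j then (1 : ℝ) else 0 := by
  have hS : (Matrix.toEuclideanLin J).IsSymmetric := Matrix.isSymmetric_toEuclideanLin_iff.2 hJ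
  induction k with
  | zero =>
    intro i hi j hj
    obtain rfl : i = 0 := by omega
    obtain rfl : j = 0 := by omega
    have : lanczosVec J b 0 = b := rfl
    simp [this, hb]
  | succ k ih =>
    have ih := ih fun j hj => h j (by omega)
    have hβ := h k (by omega)
    have key : ∀ i ≤ k, inner ℝ (lanczosVec J b i) (lanczosVec J b (k + 1)) = (0 : ℝ) := by
      intro i hi
      -- Move `J` to the left factor by symmetry; the vector subtracted on the right is a
      -- combination of `q k` and `q (k-1)`, so the induction hypothesis evaluates everything.
      have e : lanczosBeta J b k * inner ℝ (lanczosVec J b i) (lanczosVec J b (k + 1)) =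
          inner ℝ (Matrix.toEuclideanLin J (lanczosVec J b i)) (lanczosVec J b k) -
          inner ℝ (lanczosVec J b i) (Matrix.toEuclideanLin J (lanczosVec J b k) -
            lanczosBeta J b k • lanczosVec J b (k + 1)) := by
        rw [hS, inner_sub_right, real_inner_smul_right]; ring
      refine (mul_eq_zero.1 (e.trans ?_)).resolve_left hβ
      rcases Nat.eq_zero_or_pos k with rfl | hk
      · obtain rfl : i = 0 := by omega
        have e2 : Matrix.toEuclideanLin J (lanczosVec J b 0) -
            lanczosBeta J b 0 • lanczosVec J b (0 + 1) = lanczosAlpha J b 0 • lanczosVec J b 0 := by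
          rw [apply_lanczosVec_zero, zero_add]; abel
        rw [e2, real_inner_smul_right, ih 0 le_rfl 0 le_rfl, hS]
        simp [lanczosAlpha]
      · obtain ⟨l, rfl⟩ : ∃ l, k = l + 1 := ⟨k - 1, by omega⟩
        rcases eq_or_lt_of_le hi with rfl | hlt
        · have e2 : Matrix.toEuclideanLin J (lanczosVec J b (l + 1)) -
            lanczosBeta J b (l + 1) • lanczosVec J b (l + 1 + 1) =
              lanczosBeta J b l • lanczosVec J b l +
                lanczosAlpha J b (l + 1) • lanczosVec J b (l + 1) := by
            rw [apply_lanczosVec_succ]; abel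
          rw [e2, inner_add_right, real_inner_smul_right, real_inner_smul_right,
            ih _ le_rfl _ le_rfl, ih _ le_rfl _ (by omega), hS]
          simp [lanczosAlpha]
        · have e2 : Matrix.toEuclideanLin J (lanczosVec J b (l + 1)) -
            lanczosBeta J b (l + 1) • lanczosVec J b (l + 1 + 1) =
              lanczosBeta J b l • lanczosVec J b l +
                lanczosAlpha J b (l + 1) • lanczosVec J b (l + 1) := by
            rw [apply_lanczosVec_succ]; abel
          rw [e2, inner_add_right, real_inner_smul_right, real_inner_smul_right,
            ih i (by omega) l (by omega), ih i (by omega) (l + 1) le_rfl]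
          rcases i with _ | i
          · rw [apply_lanczosVec_zero, inner_add_left, real_inner_smul_left, real_inner_smul_left,
              ih 0 (by omega) _ le_rfl, ih 1 (by omega) _ le_rfl]
            by_cases hl : l = 0 <;> simp [hl, eq_comm]
          · rw [apply_lanczosVec_succ, inner_add_left, inner_add_left, real_inner_smul_left,
              real_inner_smul_left, real_inner_smul_left,
              ih i (by omega) _ le_rfl, ih (i + 1) (by omega) _ le_rfl,
              ih (i + 2) (by omega) _ le_rfl]
            by_cases hl : i + 1 = l
            · subst hl
              rw [if_neg (by omega : ¬ i = i + 1 + 1)]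
              simp
            · have h3 : i ≠ l + 1 := by omega
              have h4 : i ≠ l := by omega
              simp [hl, h3, h4]
    intro i hi j hj
    rcases eq_or_lt_of_le hi with rfl | hi' <;> rcases eq_or_lt_of_le hj with rfl | hj'
    · simp [norm_lanczosVec_succ hβ]
    · rw [real_inner_comm, key j (by omega), if_neg (by omega)]
    · rw [key i (by omega), if_neg (by omega)]
    · exact ih i (by omega) j (by omega)

/-- The tridiagonal matrix is the compression of `J` to the Lanczos vectors. The last coefficient `β
(m-1)` does not enter it and may vanish. -/
theorem inner_lanczosVec_apply (hJ : J.IsHermitian) (hb : ‖b‖ = 1) {m : ℕ}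
    (h : ∀ j, j + 1 < m → lanczosBeta J b j ≠ 0) (i j : Fin m) :
    inner ℝ (lanczosVec J b i) (Matrix.toEuclideanLin J (lanczosVec J b j)) = lanczosT J b m i j := by
  have hS : (Matrix.toEuclideanLin J).IsSymmetric := Matrix.isSymmetric_toEuclideanLin_iff.2 hJ
  have ho := inner_lanczosVec hJ hb (m - 1) fun j hj => h j (by omega)
  have key : ∀ i j : ℕ, i < j → j < m →
      inner ℝ (Matrix.toEuclideanLin J (lanczosVec J b i)) (lanczosVec J b j) =
        if i + 1 = j then lanczosBeta J b i else 0 := by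
    intro i j hij hj
    have h1 := ho i (by omega) j (by omega)
    have h2 := ho (i + 1) (by omega) j (by omega)
    rw [if_neg (by omega)] at h1
    rcases i with _ | i
    · rw [apply_lanczosVec_zero, inner_add_left, real_inner_smul_left, real_inner_smul_left, h1, h2]
      simp
    · have h3 := ho i (by omega) j (by omega)
      rw [if_neg (by omega)] at h3
      rw [apply_lanczosVec_succ, inner_add_left, inner_add_left, real_inner_smul_left,
        real_inner_smul_left, real_inner_smul_left, h1, h2, h3]
      simp
  rcases lt_trichotomy i j with hij | rfl | hij
  · rw [← hS, key i j hij j.2, lanczosT]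
    have h1 : ¬ (j : ℕ) + 1 = i := by have : (i : ℕ) < j := hij; omega
    simp [hij.ne, h1]
  · simp [lanczosT, lanczosAlpha]
  · rw [real_inner_comm, key j i hij i.2, lanczosT]
    have h1 : ¬ (i : ℕ) + 1 = j := by have : (j : ℕ) < i := hij; omega
    simp [hij.ne', h1]

theorem lanczosT_isHermitian (J : Matrix (Fin n) (Fin n) ℝ) (b : EuclideanSpace ℝ (Fin n)) (m : ℕ) :
    (lanczosT J b m).IsHermitian := by
  ext i j
  simp only [Matrix.conjTranspose_apply, lanczosT, Matrix.of_apply, star_trivial]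
  rcases eq_or_ne i j with rfl | hij
  · simp
  · rw [if_neg hij.symm, if_neg hij]
    split_ifs <;> first | rfl | omega

theorem norm_sum_smul_lanczosVec (hJ : J.IsHermitian) (hb : ‖b‖ = 1) {m : ℕ}
    (h : ∀ j, j + 1 < m → lanczosBeta J b j ≠ 0) (z : EuclideanSpace ℝ (Fin m)) :
    ‖∑ i, z i • lanczosVec J b i‖ = ‖z‖ := by
  have ho := inner_lanczosVec hJ hb (m - 1) fun j hj => h j (by omega)
  have hon : Orthonormal ℝ fun i : Fin m => lanczosVec J b i := by
    rw [orthonormal_iff_ite]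
    intro i j
    rw [ho i (by omega) j (by omega)]
    simp [Fin.ext_iff]
  rw [← sq_eq_sq₀ (norm_nonneg _) (norm_nonneg _), ← real_inner_self_eq_norm_sq, hon.inner_sum,
    EuclideanSpace.norm_sq_eq]
  simp [pow_two]

theorem inner_sum_smul_lanczosVec (hJ : J.IsHermitian) (hb : ‖b‖ = 1) {m : ℕ}
    (h : ∀ j, j + 1 < m → lanczosBeta J b j ≠ 0) (z : EuclideanSpace ℝ (Fin m)) :
    inner ℝ (∑ i, z i • lanczosVec J b i)
      (Matrix.toEuclideanLin J (∑ i, z i • lanczosVec J b i)) =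
    inner ℝ z (Matrix.toEuclideanLin (lanczosT J b m) z) := by
  rw [map_sum, sum_inner, PiLp.inner_apply]
  refine Finset.sum_congr rfl fun i _ => ?_
  rw [inner_sum, Matrix.ofLp_toLpLin, Matrix.toLin'_apply]
  simp only [map_smul, real_inner_smul_left, real_inner_smul_right,
    inner_lanczosVec_apply hJ hb h, Matrix.mulVec, dotProduct]
  simp only [RCLike.inner_apply, conj_trivial, Finset.sum_mul]
  refine Finset.sum_congr rfl fun j _ => by ring

/-- The budget `N` bounds the degree even if the method stops at `m < N`: a zero residual means that
the span of the first `m` vectors is `J`-invariant, so early termination loses nothing. -/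
theorem pow_apply_mem_span {N m : ℕ} (h : LanczosRuns J b N m) (k : ℕ) (hk : k < N) :
    ((Matrix.toEuclideanLin J) ^ k) b ∈
      Submodule.span ℝ ((fun j => lanczosVec J b j) '' {j | j ≤ k ∧ j < m}) := by
  induction k with
  | zero => exact Submodule.subset_span ⟨0, ⟨le_rfl, h.1⟩, rfl⟩
  | succ k ih =>
    rw [pow_succ', Module.End.mul_apply]
    have hmem : ∀ i ≤ k + 1, i < m → lanczosVec J b i ∈
        Submodule.span ℝ ((fun j => lanczosVec J b j) '' {j | j ≤ k + 1 ∧ j < m}) :=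
      fun i h1 h2 => Submodule.subset_span ⟨i, ⟨h1, h2⟩, rfl⟩
    have hle : Submodule.span ℝ ((fun j => lanczosVec J b j) '' {j | j ≤ k ∧ j < m}) ≤
        (Submodule.span ℝ ((fun j => lanczosVec J b j) '' {j | j ≤ k + 1 ∧ j < m})).comap
          (Matrix.toEuclideanLin J) := by
      rw [Submodule.span_le]
      rintro _ ⟨j, ⟨hj1, hj2⟩, rfl⟩
      have hnext : lanczosBeta J b j • lanczosVec J b (j + 1) ∈
          Submodule.span ℝ ((fun j => lanczosVec J b j) '' {j | j ≤ k + 1 ∧ j < m}) := by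
        by_cases hjm : j + 1 < m
        · exact Submodule.smul_mem _ _ (hmem _ (by omega) hjm)
        -- Here `j = m - 1`, and `m < N` because `k + 1 < N`; so the run ended by a zero residual.
        · have h0 : lanczosBeta J b (m - 1) = 0 := h.2.2.2.resolve_left (by omega)
          have : m - 1 = j := by omega
          rw [this] at h0
          simp [h0]
      simp only [Submodule.comap_coe, Set.mem_preimage, SetLike.mem_coe]
      rcases j with _ | j
      · rw [apply_lanczosVec_zero]
        exact Submodule.add_mem _ (Submodule.smul_mem _ _ (hmem _ (by omega) hj2)) hnext
      · rw [apply_lanczosVec_succ]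
        exact Submodule.add_mem _ (Submodule.add_mem _
          (Submodule.smul_mem _ _ (hmem _ (by omega) (by omega)))
          (Submodule.smul_mem _ _ (hmem _ (by omega) hj2))) hnext
    exact hle (ih (by omega))

theorem aeval_apply_eq_sum {N m : ℕ} (h : LanczosRuns J b N m) (p : Polynomial ℝ)
    (hp : p.natDegree < N) :
    ∃ z : EuclideanSpace ℝ (Fin m),
      Polynomial.aeval (Matrix.toEuclideanLin J) p b = ∑ i, z i • lanczosVec J b i := by
  have hmem : Polynomial.aeval (Matrix.toEuclideanLin J) p b ∈
      Submodule.span ℝ (Set.range fun i : Fin m => lanczosVec J b i) := by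
    rw [Polynomial.aeval_eq_sum_range, LinearMap.sum_apply]
    refine Submodule.sum_mem _ fun k hk => ?_
    rw [LinearMap.smul_apply]
    refine Submodule.smul_mem _ _ (Submodule.span_mono ?_ (pow_apply_mem_span h k ?_))
    · rintro _ ⟨j, ⟨_, hj⟩, rfl⟩
      exact ⟨⟨j, hj⟩, rfl⟩
    · have := Finset.mem_range.1 hk; omega
  obtain ⟨z, hz⟩ := (Submodule.mem_span_range_iff_exists_fun ℝ).1 hmem
  exact ⟨WithLp.toLp 2 z, hz.symm⟩

theorem IsLanczosOutput.norm_eq_one {N : ℕ} {u : EuclideanSpace ℝ (Fin n)}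
    (hJ : J.IsHermitian) (hb : ‖b‖ = 1) (hu : IsLanczosOutput J b N u) : ‖u‖ = 1 := by
  obtain ⟨m, hm, y, lam, hy, -, -, rfl⟩ := hu
  rw [norm_sum_smul_lanczosVec hJ hb hm.2.2.1, hy]

/-- The Ritz value of the Lanczos method maximizes the Rayleigh quotient over the Krylov space. -/
theorem IsLanczosOutput.inner_aeval_le {N : ℕ} {u : EuclideanSpace ℝ (Fin n)}
    (hJ : J.IsHermitian) (hb : ‖b‖ = 1) (hu : IsLanczosOutput J b N u) (p : Polynomial ℝ)
    (hp : p.natDegree < N) :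
    inner ℝ (Polynomial.aeval (Matrix.toEuclideanLin J) p b)
      (Matrix.toEuclideanLin J (Polynomial.aeval (Matrix.toEuclideanLin J) p b)) ≤
    inner ℝ u (Matrix.toEuclideanLin J u) *
      ‖Polynomial.aeval (Matrix.toEuclideanLin J) p b‖ ^ 2 := by
  obtain ⟨m, hm, y, lam, hy, hlam, hmax, rfl⟩ := hu
  obtain ⟨z, hz⟩ := aeval_apply_eq_sum hm p hp
  rw [hz, inner_sum_smul_lanczosVec hJ hb hm.2.2.1, inner_sum_smul_lanczosVec hJ hb hm.2.2.1,
    norm_sum_smul_lanczosVec hJ hb hm.2.2.1, hlam, real_inner_smul_right,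
    real_inner_self_eq_norm_sq, hy]
  simpa using inner_self_apply_le
    (Matrix.isSymmetric_toEuclideanLin_iff.2 (lanczosT_isHermitian J b m)) hmax z

theorem exists_lanczosRuns (J : Matrix (Fin n) (Fin n) ℝ) (b : EuclideanSpace ℝ (Fin n)) {N : ℕ}
    (hN : 1 ≤ N) : ∃ m, LanczosRuns J b N m := by
  classical
  have hex : ∃ m, 1 ≤ m ∧ (m = N ∨ lanczosBeta J b (m - 1) = 0) := ⟨N, hN, Or.inl rfl⟩
  refine ⟨Nat.find hex, (Nat.find_spec hex).1, Nat.find_min' hex ⟨hN, Or.inl rfl⟩,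
    fun j hj h0 => ?_, (Nat.find_spec hex).2⟩
  exact Nat.find_min hex hj ⟨by omega, Or.inr (by simpa using h0)⟩

theorem exists_isLanczosOutput (J : Matrix (Fin n) (Fin n) ℝ) (b : EuclideanSpace ℝ (Fin n)) {N : ℕ}
    (hN : 1 ≤ N) : ∃ u, IsLanczosOutput J b N u := by
  obtain ⟨m, hm⟩ := exists_lanczosRuns J b hN
  have hS := Matrix.isSymmetric_toEuclideanLin_iff.2 (lanczosT_isHermitian J b m)
  have hm0 : 0 < m := hm.1
  refine ⟨_, m, hm, hS.eigenvectorBasis finrank_euclideanSpace_fin ⟨0, hm0⟩,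
    hS.eigenvalues finrank_euclideanSpace_fin ⟨0, hm0⟩, OrthonormalBasis.norm_eq_one _ _,
    hS.apply_eigenvectorBasis finrank_euclideanSpace_fin ⟨0, hm0⟩,
    fun ν hν => ?_, rfl⟩
  obtain ⟨i, hi⟩ := hS.exists_eigenvalues_eq finrank_euclideanSpace_fin hν
  rw [← show hS.eigenvalues finrank_euclideanSpace_fin i = ν by simpa using hi]
  exact hS.eigenvalues_antitone _ (Fin.mk_le_of_le_val (Nat.zero_le _))

end Lanczos

/-! ### Chebyshev polynomials of half-integer degree -/

section Chebyshev

/-- The polynomial of degree `k` with `sin θ * p (cos² θ) = sin ((2 k + 1) θ)`. -/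
def oddChebyshev : ℕ → Polynomial ℝ
  | 0 => 1
  | 1 => 4 * Polynomial.X - 1
  | k + 2 => 2 * (2 * Polynomial.X - 1) * oddChebyshev (k + 1) - oddChebyshev k

theorem natDegree_oddChebyshev_le (k : ℕ) : (oddChebyshev k).natDegree ≤ k := by
  induction k using Nat.twoStepInduction with
  | zero => simp [oddChebyshev]
  | one => rw [oddChebyshev]; compute_degree
  | more k h1 h2 =>
    rw [oddChebyshev]
    refine (Polynomial.natDegree_sub_le _ _).trans (max_le ?_ (by omega))
    refine Polynomial.natDegree_mul_le.trans ?_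
    have : (2 * (2 * Polynomial.X - 1) : Polynomial ℝ).natDegree ≤ 1 := by compute_degree
    omega

theorem sin_mul_oddChebyshev (θ : ℝ) (k : ℕ) :
    Real.sin θ * (oddChebyshev k).eval (Real.cos θ ^ 2) = Real.sin ((2 * k + 1) * θ) := by
  induction k using Nat.twoStepInduction with
  | zero => simp [oddChebyshev]
  | one =>
    have : ((2 * (1 : ℕ) + 1 : ℝ)) * θ = 3 * θ := by push_cast; ring
    rw [this, Real.sin_three_mul]
    simp only [oddChebyshev, Polynomial.eval_sub, Polynomial.eval_mul, Polynomial.eval_X,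
      Polynomial.eval_one, Polynomial.eval_ofNat, Real.cos_sq']
    ring
  | more k h1 h2 =>
    have e1 : ((2 * (k + 2 : ℕ) + 1 : ℝ)) * θ = (2 * (k + 1 : ℕ) + 1) * θ + 2 * θ := by
      push_cast; ring
    have e2 : ((2 * k + 1 : ℝ)) * θ = (2 * (k + 1 : ℕ) + 1) * θ - 2 * θ := by push_cast; ring
    rw [e2, Real.sin_sub] at h1
    rw [e1, Real.sin_add, oddChebyshev]
    simp only [Polynomial.eval_sub, Polynomial.eval_mul, Polynomial.eval_X,
      Polynomial.eval_one, Polynomial.eval_ofNat]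
    rw [show 2 * Real.cos θ ^ 2 - 1 = Real.cos (2 * θ) from (Real.cos_two_mul θ).symm]
    linear_combination 2 * Real.cos (2 * θ) * h2 - h1

/-- The trigonometric identity at an imaginary angle; it gives the growth of the polynomial beyond
`1`. -/
theorem sinh_mul_oddChebyshev (φ : ℝ) (k : ℕ) :
    Real.sinh φ * (oddChebyshev k).eval (Real.cosh φ ^ 2) = Real.sinh ((2 * k + 1) * φ) := by
  induction k using Nat.twoStepInduction with
  | zero => simp [oddChebyshev]
  | one =>
    have : ((2 * (1 : ℕ) + 1 : ℝ)) * φ = 3 * φ := by push_cast; ring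
    rw [this, Real.sinh_three_mul]
    simp only [oddChebyshev, Polynomial.eval_sub, Polynomial.eval_mul, Polynomial.eval_X,
      Polynomial.eval_one, Polynomial.eval_ofNat, Real.cosh_sq]
    ring
  | more k h1 h2 =>
    have e1 : ((2 * (k + 2 : ℕ) + 1 : ℝ)) * φ = (2 * (k + 1 : ℕ) + 1) * φ + 2 * φ := by
      push_cast; ring
    have e2 : ((2 * k + 1 : ℝ)) * φ = (2 * (k + 1 : ℕ) + 1) * φ - 2 * φ := by push_cast; ring
    rw [e2, Real.sinh_sub] at h1
    rw [e1, Real.sinh_add, oddChebyshev]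
    simp only [Polynomial.eval_sub, Polynomial.eval_mul, Polynomial.eval_X,
      Polynomial.eval_one, Polynomial.eval_ofNat]
    rw [show 2 * Real.cosh φ ^ 2 - 1 = Real.cosh (2 * φ) by
      rw [Real.cosh_two_mul, Real.sinh_sq]; ring]
    linear_combination 2 * Real.cosh (2 * φ) * h2 - h1

/-- For `s = cos² θ` the left side is `sin² ((2k + 1) θ)`. -/
theorem one_sub_mul_oddChebyshev_sq_le {s : ℝ} (h0 : 0 ≤ s) (h1 : s ≤ 1) (k : ℕ) :
    (1 - s) * (oddChebyshev k).eval s ^ 2 ≤ 1 := by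
  have hs : Real.cos (Real.arccos (√s)) ^ 2 = s := by
    rw [Real.cos_arccos (by linarith [Real.sqrt_nonneg s]) (Real.sqrt_le_one.2 h1),
      Real.sq_sqrt h0]
  have h := sin_mul_oddChebyshev (Real.arccos (√s)) k
  rw [hs] at h
  calc (1 - s) * (oddChebyshev k).eval s ^ 2
      = (Real.sin (Real.arccos (√s)) * (oddChebyshev k).eval s) ^ 2 := by
        rw [mul_pow, Real.sin_sq, hs]
    _ ≤ 1 := by rw [h]; exact Real.sin_sq_le_one _

/-- At `x = tanh φ` this is `sinh φ ≤ φ cosh φ`, whose two sides agree at `0` and whose difference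
has derivative `φ sinh φ`. -/
theorem self_le_artanh {x : ℝ} (h0 : 0 ≤ x) (h1 : x < 1) : x ≤ Real.artanh x := by
  have hx : x ∈ Set.Ioo (-1 : ℝ) 1 := ⟨by linarith, h1⟩
  have hφ := Real.artanh_nonneg h0
  have key : Real.sinh (Real.artanh x) ≤ Real.artanh x * Real.cosh (Real.artanh x) := by
    have hd : ∀ t, HasDerivAt (fun t => t * Real.cosh t - Real.sinh t) (t * Real.sinh t) t := by
      intro t
      convert! ((hasDerivAt_id t).mul (Real.hasDerivAt_cosh t)).sub (Real.hasDerivAt_sinh t) using 1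
      simp
    have hm : MonotoneOn (fun t => t * Real.cosh t - Real.sinh t) (Set.Ici 0) :=
      monotoneOn_of_deriv_nonneg (convex_Ici 0) (by fun_prop) (by fun_prop) fun t ht => by
        rw [interior_Ici, Set.mem_Ioi] at ht
        rw [(hd t).deriv]
        exact mul_nonneg ht.le (Real.sinh_nonneg_iff.2 ht.le)
    have := hm (Set.mem_Ici.2 le_rfl) (Set.mem_Ici.2 hφ) hφ
    simp only [Real.sinh_zero, zero_mul, sub_zero] at this
    linarith
  rw [Real.sinh_artanh hx, Real.cosh_artanh hx] at key
  have hs : 0 < √(1 - x ^ 2) := Real.sqrt_pos.2 (by nlinarith)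
  rw [mul_one_div] at key
  exact (div_le_div_iff_of_pos_right hs).1 key

end Chebyshev

/-! ### The accuracy of the Lanczos method -/

section Accuracy

variable {n : ℕ} {T : EuclideanSpace ℝ (Fin n) →ₗ[ℝ] EuclideanSpace ℝ (Fin n)}

theorem repr_aeval_apply (hT : T.IsSymmetric) (p : Polynomial ℝ) (x : EuclideanSpace ℝ (Fin n))
    (i : Fin n) :
    (hT.eigenvectorBasis finrank_euclideanSpace_fin).repr (Polynomial.aeval T p x) i =
      p.eval (hT.eigenvalues finrank_euclideanSpace_fin i) *
        (hT.eigenvectorBasis finrank_euclideanSpace_fin).repr x i := by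
  have hpow : ∀ (k : ℕ) (y : EuclideanSpace ℝ (Fin n)),
      (hT.eigenvectorBasis finrank_euclideanSpace_fin).repr ((T ^ k) y) i =
      hT.eigenvalues finrank_euclideanSpace_fin i ^ k *
        (hT.eigenvectorBasis finrank_euclideanSpace_fin).repr y i := by
    intro k
    induction k with
    | zero => simp
    | succ k ih =>
      intro y
      rw [pow_succ, Module.End.mul_apply, ih, hT.eigenvectorBasis_apply_self_apply]
      simp only [RCLike.ofReal_real_eq_id, id_eq]
      ring
  rw [Polynomial.aeval_eq_sum_range, Polynomial.eval_eq_sum_range, LinearMap.sum_apply, map_sum,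
    WithLp.ofLp_sum, Finset.sum_apply, Finset.sum_mul]
  refine Finset.sum_congr rfl fun k _ => ?_
  rw [LinearMap.smul_apply, map_smul, PiLp.smul_apply, hpow, smul_eq_mul, mul_assoc]

/-- If the Rayleigh quotients on a Krylov space miss the largest eigenvalue by a relative error of
more than `ε`, then the starting vector is almost orthogonal to the top eigenvector. -/
theorem abs_repr_le_of_krylov (hT : T.IsSymmetric)
    (hpos : ∀ i, 0 ≤ hT.eigenvalues finrank_euclideanSpace_fin i)
    {N : ℕ} (hN : 1 ≤ N) {b : EuclideanSpace ℝ (Fin n)} (hb : ‖b‖ = 1) (i₀ : Fin n)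
    (htop : 0 < hT.eigenvalues finrank_euclideanSpace_fin i₀) {ε ξ : ℝ} (hε0 : 0 < ε) (hε1 : ε < 1)
    (hξ : ξ ≤ (1 - ε) * hT.eigenvalues finrank_euclideanSpace_fin i₀)
    (hK : ∀ p : Polynomial ℝ, p.natDegree < N →
      inner ℝ (Polynomial.aeval T p b) (T (Polynomial.aeval T p b)) ≤
        ξ * ‖Polynomial.aeval T p b‖ ^ 2) :
    |(hT.eigenvectorBasis finrank_euclideanSpace_fin).repr b i₀| ≤
      2 * Real.exp (-((2 * N - 1) * √ε)) := by
  set lam := hT.eigenvalues finrank_euclideanSpace_fin with hlam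
  set B := hT.eigenvectorBasis finrank_euclideanSpace_fin with hB
  set a := (1 - ε) * lam i₀ with ha
  have ha0 : 0 < a := mul_pos (by linarith) htop
  obtain ⟨k, rfl⟩ : ∃ k, N = k + 1 := ⟨N - 1, by omega⟩
  -- The scaling sends `[0, a]` to `[0, 1]`. The degree `k = N - 1` is the largest the Krylov space
  -- allows, and `2k + 1 = 2N - 1` is the rate in the exponent.
  set p : Polynomial ℝ := (oddChebyshev k).comp (Polynomial.C a⁻¹ * Polynomial.X) with hp
  have hpdeg : p.natDegree < k + 1 := by
    have h1 : (Polynomial.C a⁻¹ * Polynomial.X : Polynomial ℝ).natDegree ≤ 1 := by compute_degree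
    have h2 := natDegree_oddChebyshev_le k
    have h3 := Polynomial.natDegree_comp_le (p := oddChebyshev k)
      (q := Polynomial.C a⁻¹ * Polynomial.X)
    have : (oddChebyshev k).natDegree * (Polynomial.C a⁻¹ * Polynomial.X : Polynomial ℝ).natDegree
      ≤ k * 1 := Nat.mul_le_mul h2 h1
    rw [hp]; omega
  have hpe : ∀ t, p.eval t = (oddChebyshev k).eval (a⁻¹ * t) := fun t => by
    simp [hp, Polynomial.eval_comp]
  have hineq := (hK p hpdeg).trans
    (mul_le_mul_of_nonneg_right hξ (sq_nonneg ‖Polynomial.aeval T p b‖))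
  rw [inner_self_apply_eq_sum hT, norm_sq_eq_sum_repr B, Finset.mul_sum, ← sub_nonneg,
    ← Finset.sum_sub_distrib] at hineq
  simp only [hB, repr_aeval_apply hT] at hineq
  simp only [← hB, ← hlam] at hineq
  -- Chosen so that `cosh² φ = 1 / (1 - ε)`, the position of the top eigenvalue after scaling.
  set φ := Real.artanh √ε with hφ
  have hsε : √ε ∈ Set.Ioo (-1 : ℝ) 1 :=
    ⟨by linarith [Real.sqrt_nonneg ε], by rw [Real.sqrt_lt' one_pos]; simpa using hε1⟩
  have hcosh : Real.cosh φ ^ 2 = a⁻¹ * lam i₀ := by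
    rw [hφ, Real.cosh_artanh hsε, Real.sq_sqrt hε0.le, div_pow, Real.sq_sqrt (by linarith), ha]
    field_simp
  have htopval : (a - lam i₀) * p.eval (lam i₀) ^ 2 =
      a * (1 - Real.cosh ((2 * k + 1) * φ) ^ 2) := by
    have e : a * Real.cosh φ ^ 2 = lam i₀ := by rw [hcosh]; field_simp
    rw [hpe, ← hcosh, ← e, Real.cosh_sq ((2 * k + 1) * φ), ← sinh_mul_oddChebyshev, Real.cosh_sq]
    ring
  have hother : ∀ i, (a - lam i) * p.eval (lam i) ^ 2 ≤ a := by
    intro i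
    rcases le_total (lam i) a with hle | hle
    · have := one_sub_mul_oddChebyshev_sq_le (s := a⁻¹ * lam i)
        (mul_nonneg (inv_nonneg.2 ha0.le) (hpos i))
        (by rw [inv_mul_le_iff₀ ha0]; simpa using hle) k
      rw [hpe]
      calc _ = a * ((1 - a⁻¹ * lam i) * (oddChebyshev k).eval (a⁻¹ * lam i) ^ 2) := by
            field_simp
        _ ≤ a * 1 := by gcongr
        _ = a := mul_one a
    · exact (mul_nonpos_of_nonpos_of_nonneg (by linarith) (sq_nonneg _)).trans ha0.le
  -- The top term is `-a sinh²`, written as `a - a cosh²`; its `a` joins the bounds of the other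
  -- terms, and the squared coordinates of `b` sum to `1`. As the sum is nonnegative, `cosh² · (b
  -- i₀)² ≤ 1`.
  have hsum : ∑ i, (a * (p.eval (lam i) * B.repr b i) ^ 2 - lam i * (p.eval (lam i) * B.repr b i) ^ 2)
      ≤ a - a * Real.cosh ((2 * k + 1) * φ) ^ 2 * B.repr b i₀ ^ 2 := by
    have hb2 : ∑ i, B.repr b i ^ 2 = 1 := by rw [← norm_sq_eq_sum_repr, hb, one_pow]
    calc _ ≤ ∑ i, (a * B.repr b i ^ 2 -
          if i = i₀ then a * Real.cosh ((2 * k + 1) * φ) ^ 2 * B.repr b i ^ 2 else 0) := by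
          refine Finset.sum_le_sum fun i _ => ?_
          split_ifs with hi
          · subst hi
            refine le_of_eq ?_
            linear_combination B.repr b i ^ 2 * htopval
          · have := mul_le_mul_of_nonneg_right (hother i) (sq_nonneg (B.repr b i))
            linarith
      _ = _ := by
          rw [Finset.sum_sub_distrib, ← Finset.mul_sum, hb2]
          simp
  have hfin : (Real.cosh ((2 * k + 1) * φ) * |B.repr b i₀|) ^ 2 ≤ 1 := by
    rw [mul_pow, sq_abs]
    have := hineq.trans hsum
    by_contra! hcon
    nlinarith
  have hfin' : Real.cosh ((2 * k + 1) * φ) * |B.repr b i₀| ≤ 1 := by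
    exact (le_abs_self _).trans ((sq_le_one_iff_abs_le_one _).1 hfin)
  have hexp : Real.exp ((2 * k + 1) * √ε) / 2 ≤ Real.cosh ((2 * k + 1) * φ) := by
    have h1 : (2 * k + 1) * √ε ≤ (2 * k + 1) * φ :=
      mul_le_mul_of_nonneg_left (self_le_artanh (Real.sqrt_nonneg ε) hsε.2) (by positivity)
    have h2 := Real.exp_le_exp.2 h1
    rw [Real.cosh_eq]
    have := Real.exp_pos (-((2 * k + 1) * φ))
    linarith
  have hmul := (mul_le_mul_of_nonneg_right hexp (abs_nonneg (B.repr b i₀))).trans hfin'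
  have hcast : (2 * ((k + 1 : ℕ) : ℝ) - 1) * √ε = (2 * k + 1) * √ε := by push_cast; ring
  rw [hcast, Real.exp_neg, ← div_eq_mul_inv, le_div_iff₀ (Real.exp_pos _)]
  linarith

end Accuracy

/-! ### The standard Gaussian measure in coordinates -/

section Gaussian

open ProbabilityTheory

theorem lintegral_fin_prod_eq_prod {n : ℕ} {μ : Fin n → Measure ℝ} [∀ i, SigmaFinite (μ i)]
    {f : Fin n → ℝ → ENNReal} (hf : ∀ i, Measurable (f i)) :
    ∫⁻ x : Fin n → ℝ, ∏ i, f i (x i) ∂(Measure.pi μ) = ∏ i, ∫⁻ t, f i t ∂(μ i) := by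
  induction n with
  | zero => simp
  | succ n ih =>
    have hm := (measurePreserving_piFinSuccAbove μ 0).symm
    rw [← hm.lintegral_comp (by fun_prop)]
    simp only [Fin.prod_univ_succ, MeasurableEquiv.piFinSuccAbove_symm_apply,
      Fin.insertNthEquiv_apply, Fin.insertNth_zero', Fin.cons_zero, Fin.cons_succ]
    rw [lintegral_prod_mul (f := f 0) (g := fun y : Fin n → ℝ => ∏ i : Fin n, f i.succ (y i))
      (hf 0).aemeasurable (Finset.measurable_prod _ fun i _ =>
        (hf i.succ).comp (measurable_pi_apply i)).aemeasurable]
    simp only [Fin.zero_succAbove]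
    rw [ih fun i => hf i.succ]

theorem pi_gaussianReal_eq_withDensity (n : ℕ) :
    Measure.pi (fun _ : Fin n => gaussianReal 0 1) =
      (volume : Measure (Fin n → ℝ)).withDensity fun x => ∏ i, gaussianPDF 0 1 (x i) := by
  refine Measure.pi_eq fun s hs => ?_
  rw [withDensity_apply _ (MeasurableSet.univ_pi hs),
    ← lintegral_indicator (MeasurableSet.univ_pi hs)]
  have h : ∀ x : Fin n → ℝ, (Set.univ.pi s).indicator (fun x => ∏ i, gaussianPDF 0 1 (x i)) x =
      ∏ i, (s i).indicator (gaussianPDF 0 1) (x i) := by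
    intro x
    by_cases hx : x ∈ Set.univ.pi s
    · rw [Set.indicator_of_mem hx]
      exact Finset.prod_congr rfl fun i _ => (Set.indicator_of_mem (hx i trivial) _).symm
    · rw [Set.indicator_of_notMem hx]
      obtain ⟨i, hi⟩ : ∃ i, x i ∉ s i := by simpa using hx
      exact (Finset.prod_eq_zero (Finset.mem_univ i) (Set.indicator_of_notMem hi _)).symm
  simp only [h]
  rw [volume_pi, lintegral_fin_prod_eq_prod fun i => (measurable_gaussianPDF 0 1).indicator (hs i)]
  refine Finset.prod_congr rfl fun i _ => ?_
  rw [lintegral_indicator (hs i), gaussianReal_apply 0 one_ne_zero]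

/-- The density of the standard Gaussian measure on `ℝⁿ` as a function of the norm. -/
def gaussianRadial (n : ℕ) (r : ℝ) : ENNReal :=
  ENNReal.ofReal ((√(2 * Real.pi))⁻¹ ^ n * Real.exp (-r ^ 2 / 2))

theorem measurable_gaussianRadial (n : ℕ) : Measurable (gaussianRadial n) := by
  unfold gaussianRadial; fun_prop

theorem prod_gaussianPDF (n : ℕ) (x : Fin n → ℝ) :
    ∏ i, gaussianPDF 0 1 (x i) = gaussianRadial n ‖WithLp.toLp 2 x‖ := by
  simp only [gaussianPDF, gaussianRadial]
  rw [← ENNReal.ofReal_prod_of_nonneg fun i _ => gaussianPDFReal_nonneg _ _ _,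
    EuclideanSpace.norm_sq_eq]
  congr 1
  simp only [gaussianPDFReal, NNReal.coe_one, mul_one, sub_zero, Finset.prod_mul_distrib,
    Finset.prod_const, Finset.card_univ, Fintype.card_fin, Real.norm_eq_abs, sq_abs]
  rw [← Real.exp_sum, ← Finset.sum_div, Finset.sum_neg_distrib]

/-- The density is at most `1 / √(2π) ≤ 1 / 2` and the interval has length `2 r`. -/
theorem gaussianReal_abs_le (r : ℝ) : gaussianReal 0 1 {s | |s| ≤ r} ≤ ENNReal.ofReal r := by
  have hset : {s : ℝ | |s| ≤ r} = Set.Icc (-r) r := by ext s; simp [abs_le]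
  rw [hset, gaussianReal_apply 0 one_ne_zero]
  have hpdf : ∀ s, gaussianPDF 0 1 s ≤ ENNReal.ofReal (1 / 2) := by
    intro s
    refine ENNReal.ofReal_le_ofReal ?_
    have h2 : 2 ≤ √(2 * Real.pi) := Real.le_sqrt_of_sq_le (by linarith [Real.pi_gt_three])
    rw [gaussianPDFReal]
    simp only [NNReal.coe_one, mul_one, sub_zero]
    calc (√(2 * Real.pi))⁻¹ * Real.exp (-s ^ 2 / 2) ≤ 2⁻¹ * 1 := by
          gcongr
          rw [Real.exp_le_one_iff]
          nlinarith [sq_nonneg s]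
      _ = 1 / 2 := by norm_num
  calc ∫⁻ x in Set.Icc (-r) r, gaussianPDF 0 1 x
      ≤ ∫⁻ _ in Set.Icc (-r) r, ENNReal.ofReal (1 / 2) := lintegral_mono fun s => hpdf s
    _ = ENNReal.ofReal r := by
        rw [setLIntegral_const, Real.volume_Icc, ← ENNReal.ofReal_mul (by norm_num)]
        congr 1
        ring

theorem integral_sq_gaussianReal : ∫ s, s ^ 2 ∂(gaussianReal 0 1) = 1 := by
  have h := variance_id_gaussianReal (μ := 0) (v := 1)
  rw [variance_of_integral_eq_zero aemeasurable_id (by simp)] at h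
  simpa using h

theorem integrable_sq_gaussianReal : Integrable (fun s : ℝ => s ^ 2) (gaussianReal 0 1) :=
  (memLp_id_gaussianReal (μ := 0) (v := 1) 2).integrable_sq

theorem integrable_eval_sq_pi_gaussianReal {k : ℕ} (j : Fin k) :
    Integrable (fun y : Fin k → ℝ => y j ^ 2) (Measure.pi fun _ => gaussianReal 0 1) :=
  integrable_comp_eval (μ := fun _ : Fin k => gaussianReal 0 1) (i := j)
    (f := fun s : ℝ => s ^ 2) integrable_sq_gaussianReal

theorem integral_sum_sq_pi_gaussianReal (k : ℕ) :
    ∫ y : Fin k → ℝ, ∑ j, y j ^ 2 ∂(Measure.pi fun _ => gaussianReal 0 1) = k := by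
  rw [integral_finsetSum _ fun j _ => integrable_eval_sq_pi_gaussianReal j]
  have : ∀ j : Fin k, ∫ y : Fin k → ℝ, y j ^ 2 ∂(Measure.pi fun _ => gaussianReal 0 1) = 1 :=
    fun j => (integral_comp_eval (μ := fun _ : Fin k => gaussianReal 0 1) (i := j)
      (f := fun s : ℝ => s ^ 2) integrable_sq_gaussianReal.aestronglyMeasurable).trans
        integral_sq_gaussianReal
  simp [this]

/-- A coordinate of a standard Gaussian vector is rarely a small fraction of its norm. -/
theorem pi_gaussianReal_abs_le_mul_norm {n : ℕ} (i₀ : Fin n) {t : ℝ} (ht : 0 < t) :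
    Measure.pi (fun _ : Fin n => gaussianReal 0 1) {x | |x i₀| ≤ t * ‖WithLp.toLp 2 x‖} ≤
      ENNReal.ofReal (t * √n) := by
  rcases le_or_gt 1 (t * √n) with h1 | h1
  · exact prob_le_one.trans (by simpa using h1)
  obtain ⟨k, rfl⟩ : ∃ k, n = k + 1 := ⟨n - 1, by have := i₀.pos; omega⟩
  set σ := t * √((k + 1 : ℕ) : ℝ) with hσ
  have hσ0 : 0 < σ := by positivity
  have hσ2 : σ ^ 2 = t ^ 2 * (k + 1) := by
    rw [hσ, mul_pow, Real.sq_sqrt (by positivity)]; push_cast; rfl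
  have hσ1 : σ ^ 2 < 1 := by nlinarith
  have ht1 : 0 < 1 - t ^ 2 := by nlinarith [mul_nonneg (sq_nonneg t) (Nat.cast_nonneg (α := ℝ) k)]
  -- The cone condition solved for the distinguished coordinate: `x i₀ ^ 2 ≤ q R`, with `R` the sum
  -- of the other squares.
  set q := t ^ 2 / (1 - t ^ 2) with hq
  have hq0 : 0 < q := by positivity
  have hqk : q * k ≤ σ ^ 2 := by
    rw [hq, div_mul_eq_mul_div, div_le_iff₀ ht1, hσ2]
    nlinarith [mul_nonneg (sq_nonneg t) (sub_nonneg.2 hσ1.le)]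
  -- The arithmetic-geometric mean bound for `√(q R)` with weight `σ`. It is linear in `R`, so its
  -- expectation needs only `E R = k`, and `q k ≤ σ²` makes that expectation at most `σ`.
  set g : (Fin k → ℝ) → ℝ := fun y => (q * (∑ j, y j ^ 2) / σ + σ) / 2 with hg
  have hg0 : ∀ y, 0 ≤ g y := fun y => by
    have : 0 ≤ ∑ j, y j ^ 2 := Finset.sum_nonneg fun j _ => sq_nonneg _
    positivity
  have hsub : {x : Fin (k + 1) → ℝ | |x i₀| ≤ t * ‖WithLp.toLp 2 x‖} ⊆
      (MeasurableEquiv.piFinSuccAbove (fun _ => ℝ) i₀) ⁻¹' {z : ℝ × (Fin k → ℝ) | |z.1| ≤ g z.2} := by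
    intro x hx
    have hx' : |x i₀| ≤ t * ‖WithLp.toLp 2 x‖ := hx
    have h2 := pow_le_pow_left₀ (abs_nonneg _) hx' 2
    rw [mul_pow, EuclideanSpace.norm_sq_eq, Fin.sum_univ_succAbove _ i₀] at h2
    simp only [Real.norm_eq_abs, sq_abs] at h2
    change |x i₀| ≤ g (fun j => x (i₀.succAbove j))
    set R := ∑ j, x (i₀.succAbove j) ^ 2 with hR
    have h3 : x i₀ ^ 2 ≤ q * R := by
      rw [hq, div_mul_eq_mul_div, le_div_iff₀ ht1]; linarith
    rw [hg]
    simp only [← hR]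
    rw [le_div_iff₀ two_pos]
    have h4 : 2 * |x i₀| * σ ≤ x i₀ ^ 2 + σ ^ 2 := by
      rw [← sq_abs (x i₀)]; exact two_mul_le_add_sq _ _
    have h5 : |x i₀| * 2 * σ ≤ (q * R / σ + σ) * σ := by
      rw [add_mul, div_mul_cancel₀ _ hσ0.ne']; nlinarith
    exact le_of_mul_le_mul_right h5 hσ0
  have hgm : Measurable g := by fun_prop
  have hmeas : MeasurableSet {z : ℝ × (Fin k → ℝ) | |z.1| ≤ g z.2} :=
    measurableSet_le (by fun_prop) (by fun_prop)
  have hmp := measurePreserving_piFinSuccAbove (fun _ : Fin (k + 1) => gaussianReal 0 1) i₀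
  have hint : Integrable (fun y : Fin k → ℝ => ∑ j, y j ^ 2)
      (Measure.pi fun _ => gaussianReal 0 1) :=
    integrable_finsetSum _ fun j _ => integrable_eval_sq_pi_gaussianReal j
  refine (measure_mono hsub).trans ?_
  rw [hmp.measure_preimage hmeas.nullMeasurableSet, Measure.prod_apply_symm hmeas]
  calc ∫⁻ y, gaussianReal 0 1 ((fun s => (s, y)) ⁻¹' {z : ℝ × (Fin k → ℝ) | |z.1| ≤ g z.2})
        ∂(Measure.pi fun _ : Fin k => gaussianReal 0 1)
      ≤ ∫⁻ y, ENNReal.ofReal (g y) ∂(Measure.pi fun _ : Fin k => gaussianReal 0 1) :=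
        lintegral_mono fun y => gaussianReal_abs_le (g y)
    _ = ENNReal.ofReal (∫ y, g y ∂(Measure.pi fun _ : Fin k => gaussianReal 0 1)) :=
        (ofReal_integral_eq_lintegral_ofReal
          ((((hint.const_mul q).div_const σ).add (integrable_const σ)).div_const 2)
          (.of_forall hg0)).symm
    _ ≤ ENNReal.ofReal σ := by
        refine ENNReal.ofReal_le_ofReal ?_
        rw [hg, integral_div, integral_add ((hint.const_mul q).div_const σ) (integrable_const σ),
          integral_div, integral_const_mul, integral_sum_sq_pi_gaussianReal]
        simp only [integral_const, probReal_univ, one_smul]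
        have : q * k / σ ≤ σ := by rw [div_le_iff₀ hσ0]; nlinarith
        linarith

end Gaussian

/-! ### The uniform distribution on the sphere -/

section Sphere

/-- Integration of a radial function over a cone in polar coordinates. -/
theorem setLIntegral_cone_fun_norm {E : Type*} [NormedAddCommGroup E] [NormedSpace ℝ E]
    [MeasurableSpace E] [BorelSpace E] [FiniteDimensional ℝ E] [Nontrivial E] (μ : Measure E)
    [μ.IsAddHaarMeasure] {f : ℝ → ENNReal} (hf : Measurable f) {C : Set E} (hC : MeasurableSet C)
    {S : Set (Metric.sphere (0 : E) 1)} (hS : MeasurableSet S)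
    (hCS : ∀ (s : Metric.sphere (0 : E) 1) (r : ℝ), 0 < r → (r • (s : E) ∈ C ↔ s ∈ S)) :
    ∫⁻ x in C, f ‖x‖ ∂μ =
      μ.toSphere S * ∫⁻ r : Set.Ioi (0 : ℝ), f r ∂(Measure.volumeIoiPow (Module.finrank ℝ E - 1)) := by
  have hmp := μ.measurePreserving_homeomorphUnitSphereProd
  have hpt : ∀ x : ({0}ᶜ : Set E), C.indicator (fun x => f ‖x‖) (x : E) =
      S.indicator 1 (homeomorphUnitSphereProd E x).1 * f (homeomorphUnitSphereProd E x).2 := by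
    intro x
    have hx := congrArg Subtype.val ((homeomorphUnitSphereProd E).symm_apply_apply x)
    rw [homeomorphUnitSphereProd_symm_apply_coe] at hx
    have hmem := hCS (homeomorphUnitSphereProd E x).1 (homeomorphUnitSphereProd E x).2
      (homeomorphUnitSphereProd E x).2.2
    rw [hx] at hmem
    by_cases hxC : (x : E) ∈ C
    · rw [Set.indicator_of_mem hxC, Set.indicator_of_mem (hmem.1 hxC),
        homeomorphUnitSphereProd_apply_snd_coe]
      simp
    · rw [Set.indicator_of_notMem hxC, Set.indicator_of_notMem fun h => hxC (hmem.2 h), zero_mul]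
  calc ∫⁻ x in C, f ‖x‖ ∂μ = ∫⁻ x, C.indicator (fun x => f ‖x‖) x ∂μ :=
        (lintegral_indicator hC _).symm
    _ = ∫⁻ x : ({0}ᶜ : Set E), C.indicator (fun x => f ‖x‖) (x : E) ∂(μ.comap (↑)) := by
        rw [lintegral_subtype_comap (measurableSet_singleton (0 : E)).compl,
          restrict_compl_singleton]
    _ = ∫⁻ z : Metric.sphere (0 : E) 1 × Set.Ioi (0 : ℝ), S.indicator 1 z.1 * f z.2
          ∂(μ.toSphere.prod (Measure.volumeIoiPow (Module.finrank ℝ E - 1))) := by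
        simp only [hpt]
        exact hmp.lintegral_comp_emb (Homeomorph.measurableEmbedding _)
          fun z : Metric.sphere (0 : E) 1 × Set.Ioi (0 : ℝ) => S.indicator 1 z.1 * f z.2
    _ = _ := by
        rw [lintegral_prod_mul (f := S.indicator 1) (g := fun r : Set.Ioi (0 : ℝ) => f r)
          (measurable_one.indicator hS).aemeasurable
          (hf.comp measurable_subtype_coe).aemeasurable,
          lintegral_indicator_one hS]

variable {n : ℕ}

theorem isProbabilityMeasure_uniformSphere (hn : 1 ≤ n) :
    IsProbabilityMeasure (uniformSphere n) := by
  have : Nonempty (Fin n) := ⟨⟨0, hn⟩⟩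
  refine ⟨?_⟩
  rw [uniformSphere, Measure.smul_apply, smul_eq_mul]
  exact ENNReal.inv_mul_cancel (Measure.measure_univ_ne_zero.2 (Measure.toSphere_ne_zero _))
    (measure_ne_top _ _)

/-- A coordinate of a uniform point of the sphere is rarely small. -/
theorem uniformSphere_abs_repr_le
    (B : OrthonormalBasis (Fin n) ℝ (EuclideanSpace ℝ (Fin n))) (i₀ : Fin n) {t : ℝ} (ht : 0 < t) :
    uniformSphere n {b | |B.repr (b : EuclideanSpace ℝ (Fin n)) i₀| ≤ t} ≤
      ENNReal.ofReal (t * √n) := by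
  have : Nonempty (Fin n) := ⟨i₀⟩
  have hrepr : Measurable fun x : EuclideanSpace ℝ (Fin n) => B.repr x i₀ := by fun_prop
  set S : Set (Metric.sphere (0 : EuclideanSpace ℝ (Fin n)) 1) :=
    {b | |B.repr (b : EuclideanSpace ℝ (Fin n)) i₀| ≤ t} with hSdef
  set C : Set (EuclideanSpace ℝ (Fin n)) := {x | |B.repr x i₀| ≤ t * ‖x‖} with hCdef
  have hS : MeasurableSet S :=
    measurableSet_le ((continuous_abs.measurable.comp hrepr).comp measurable_subtype_coe)
      measurable_const
  have hC : MeasurableSet C :=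
    measurableSet_le (continuous_abs.measurable.comp hrepr) (by fun_prop)
  have hCS : ∀ (s : Metric.sphere (0 : EuclideanSpace ℝ (Fin n)) 1) (r : ℝ), 0 < r →
      (r • (s : EuclideanSpace ℝ (Fin n)) ∈ C ↔ s ∈ S) := by
    intro s r hr
    have hs : ‖(s : EuclideanSpace ℝ (Fin n))‖ = 1 := norm_eq_of_mem_sphere s
    simp only [hCdef, hSdef, Set.mem_ofPred_eq, map_smul, PiLp.smul_apply, smul_eq_mul, abs_mul,
      abs_of_pos hr, norm_smul, Real.norm_eq_abs, hs, mul_one]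
    rw [mul_comm t r, mul_le_mul_iff_right₀ hr]
  have hψ : MeasurePreserving (fun x : Fin n → ℝ => B.repr.symm (WithLp.toLp 2 x)) :=
    B.measurePreserving_repr_symm.comp (PiLp.volume_preserving_toLp (Fin n))
  have hgauss : ∀ D : Set (EuclideanSpace ℝ (Fin n)), MeasurableSet D →
      ∫⁻ x in D, gaussianRadial n ‖x‖ =
        Measure.pi (fun _ : Fin n => ProbabilityTheory.gaussianReal 0 1)
          ((fun x : Fin n → ℝ => B.repr.symm (WithLp.toLp 2 x)) ⁻¹' D) := by
    intro D hD
    rw [pi_gaussianReal_eq_withDensity, withDensity_apply _ (hψ.measurable hD),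
      ← hψ.setLIntegral_comp_preimage (f := fun x => gaussianRadial n ‖x‖) hD
        ((measurable_gaussianRadial n).comp measurable_norm)]
    simp only [prod_gaussianPDF, LinearIsometryEquiv.norm_map]
  have h1 := setLIntegral_cone_fun_norm volume (measurable_gaussianRadial n) hC hS hCS
  -- The cone over the whole sphere has Gaussian measure `1`, which identifies the radial integral
  -- as the normalizing constant of the uniform measure.
  have h2 := setLIntegral_cone_fun_norm (volume : Measure (EuclideanSpace ℝ (Fin n)))
    (measurable_gaussianRadial n) MeasurableSet.univ MeasurableSet.univ (fun s r _ => by simp)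
  rw [hgauss _ hC] at h1
  rw [hgauss _ MeasurableSet.univ, Set.preimage_univ, measure_univ] at h2
  set I := ∫⁻ r : Set.Ioi (0 : ℝ), gaussianRadial n r
    ∂(Measure.volumeIoiPow (Module.finrank ℝ (EuclideanSpace ℝ (Fin n)) - 1))
  have hle := pi_gaussianReal_abs_le_mul_norm i₀ ht
  have hpre : (fun x : Fin n → ℝ => B.repr.symm (WithLp.toLp 2 x)) ⁻¹' C =
      {x | |x i₀| ≤ t * ‖WithLp.toLp 2 x‖} := by
    ext x; simp [hCdef]
  rw [hpre] at h1
  have hI : ((volume : Measure (EuclideanSpace ℝ (Fin n))).toSphere Set.univ)⁻¹ = I :=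
    (ENNReal.eq_inv_of_mul_eq_one_left (by rw [mul_comm]; exact h2.symm)).symm
  rw [uniformSphere, Measure.smul_apply, smul_eq_mul, hI, mul_comm, ← h1]
  exact hle

end Sphere

/-! ### The linearized subproblem -/

section Subproblem

variable {n d : ℕ}

theorem gradient_barrier {w : EuclideanSpace ℝ (Fin d)} (hw : ∀ i, 0 < w i) :
    gradient (barrier d) w = WithLp.toLp 2 fun i => -(w i)⁻¹ := by
  refine HasGradientAt.gradient ?_
  rw [hasGradientAt_iff_hasFDerivAt]
  have hlog : ∀ i ∈ Finset.univ, HasFDerivAt (fun v : EuclideanSpace ℝ (Fin d) => Real.log (v i))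
      ((w i)⁻¹ • (EuclideanSpace.proj i : EuclideanSpace ℝ (Fin d) →L[ℝ] ℝ)) w := fun i _ =>
    ((EuclideanSpace.proj i : EuclideanSpace ℝ (Fin d) →L[ℝ] ℝ).hasFDerivAt).log (hw i).ne'
  convert! (HasFDerivAt.fun_sum hlog).neg using 1
  ext v
  simp [PiLp.inner_apply, mul_comm]

theorem grad_eq {A : Fin d → Matrix (Fin n) (Fin n) ℝ} {X : Matrix (Fin n) (Fin n) ℝ}
    (hX : X ∈ feasible A) : grad A X = -∑ i, (minner (A i) X)⁻¹ • A i := by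
  rw [grad, gradient_barrier (w := opB A X) fun i => hX.2 i]
  simp [opBAdj, opB]

theorem neg_grad_posSemidef {A : Fin d → Matrix (Fin n) (Fin n) ℝ} (hA : ∀ i, (A i).PosSemidef)
    {X : Matrix (Fin n) (Fin n) ℝ} (hX : X ∈ feasible A) : (-grad A X).PosSemidef := by
  rw [grad_eq hX, neg_neg]
  exact Matrix.posSemidef_sum _ fun i _ => (hA i).smul (inv_nonneg.2 (hX.2 i).le)

/-- Logarithmic homogeneity, `⟨∇f(w), w⟩ = -θ`: each logarithm contributes `-1`. -/
theorem linObj_self {A : Fin d → Matrix (Fin n) (Fin n) ℝ} {X : Matrix (Fin n) (Fin n) ℝ}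
    (hX : X ∈ feasible A) : linObj A X X = -d := by
  rw [linObj, grad_eq hX]
  have h : ∀ i, (minner (A i) X)⁻¹ * ((A i).transpose * X).trace = 1 := fun i =>
    inv_mul_cancel₀ (hX.2 i).ne'
  simp [minner, Matrix.transpose_sum, Matrix.sum_mul, Matrix.trace_sum] at h ⊢
  simp [h]

theorem minner_vecMulVec_self {D : Matrix (Fin n) (Fin n) ℝ} (hD : (-D).IsHermitian)
    (u : EuclideanSpace ℝ (Fin n)) :
    minner D (Matrix.vecMulVec u u) = -inner ℝ u (Matrix.toEuclideanLin (-D) u) := by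
  have hDt : D.transpose = D := by
    have := hD.eq
    simpa [Matrix.conjTranspose_eq_transpose_of_trivial] using this
  rw [minner, hDt, Matrix.mul_vecMulVec, Matrix.trace_vecMulVec, PiLp.inner_apply,
    Matrix.ofLp_toLpLin, Matrix.toLin'_apply]
  simp [dotProduct, Matrix.neg_mulVec]

theorem vecMulVec_self_mem_spectraplex {u : EuclideanSpace ℝ (Fin n)} (hu : ‖u‖ = 1) :
    Matrix.vecMulVec u u ∈ spectraplex n := by
  refine ⟨by simpa using Matrix.posSemidef_vecMulVec_self_star (u : Fin n → ℝ), ?_⟩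
  have h := EuclideanSpace.norm_sq_eq u
  rw [hu] at h
  rw [Matrix.trace_vecMulVec, dotProduct]
  simpa [pow_two] using h.symm

/-- A linear function is minimized over the spectraplex by a top eigenvector. -/
theorem neg_le_minner_of_mem_spectraplex {D : Matrix (Fin n) (Fin n) ℝ} (hD : (-D).IsHermitian)
    {lam : ℝ} (h : ∀ z : EuclideanSpace ℝ (Fin n),
      inner ℝ z (Matrix.toEuclideanLin (-D) z) ≤ lam * ‖z‖ ^ 2)
    {K : Matrix (Fin n) (Fin n) ℝ} (hK : K ∈ spectraplex n) : -lam ≤ minner D K := by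
  obtain ⟨m, v, hv⟩ := Matrix.posSemidef_iff_eq_sum_vecMulVec.1 hK.1
  have htr := hK.2
  have hsum : minner D K = ∑ i, minner D (Matrix.vecMulVec (v i) (v i)) := by
    rw [hv]; simp [minner, Matrix.mul_sum, Matrix.trace_sum]
  -- The trace condition makes the squared norms weights of a convex combination of Rayleigh
  -- quotients.
  have hnorm : ∑ i, ‖WithLp.toLp 2 (v i)‖ ^ 2 = 1 := by
    rw [← htr, hv, Matrix.trace_sum]
    refine Finset.sum_congr rfl fun i _ => ?_
    rw [EuclideanSpace.norm_sq_eq, Matrix.trace_vecMulVec, dotProduct]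
    simp [pow_two]
  rw [hsum, ← mul_one lam, ← hnorm, Finset.mul_sum, ← Finset.sum_neg_distrib]
  refine Finset.sum_le_sum fun i _ => ?_
  have := minner_vecMulVec_self hD (WithLp.toLp 2 (v i))
  rw [this]
  exact neg_le_neg (h _)

end Subproblem

/-! ### The algorithm -/

section Algorithm

variable {n d : ℕ}

theorem one_le_div_sq (hn : 1 ≤ n) {p : ℝ} (hp0 : 0 < p) (hp1 : p ≤ 1) :
    1 ≤ 4 * (n : ℝ) / p ^ 2 := by
  have hn' : (1 : ℝ) ≤ n := by exact_mod_cast hn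
  rw [one_le_div (by positivity)]
  nlinarith

theorem one_le_numIter (hn : 1 ≤ n) {p : ℝ} (hp0 : 0 < p) (hp1 : p ≤ 1) (θ c δ : ℝ) :
    1 ≤ numIter n θ c δ p := by
  have h := Real.log_nonneg (one_le_div_sq hn hp0 hp1)
  rw [numIter, Nat.one_le_ceil_iff]
  positivity

theorem exists_isAlgOutput (hn : 1 ≤ n) {p : ℝ} (hp0 : 0 < p) (hp1 : p ≤ 1) (θ c : ℝ)
    (D : Matrix (Fin n) (Fin n) ℝ) (δ : ℝ) (X : Matrix (Fin n) (Fin n) ℝ)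
    (b : EuclideanSpace ℝ (Fin n)) : ∃ out, IsAlgOutput θ c p D δ X b out := by
  obtain ⟨u, hu⟩ := exists_isLanczosOutput (-D) b (one_le_numIter hn hp0 hp1 θ c δ)
  exact ⟨_, u, hu, rfl⟩

theorem two_mul_exp_numIter_le (hn : 1 ≤ n) {θ c δ p : ℝ} (hp0 : 0 < p) (hp1 : p ≤ 1)
    (hm : 0 < min δ ((c - 2) * θ)) (hcθ : 0 < c * θ) :
    2 * Real.exp (-((2 * numIter n θ c δ p - 1) * √(min δ ((c - 2) * θ) / (c * θ)))) ≤ p / √n := by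
  set m := min δ ((c - 2) * θ) with hmdef
  set L := Real.log (4 * n / p ^ 2) with hL
  have hn0 : (0 : ℝ) < n := by exact_mod_cast hn
  have hL0 : 0 ≤ L := Real.log_nonneg (one_le_div_sq hn hp0 hp1)
  have hN : 1 / 2 + √(c * θ / (8 * m)) * L ≤ numIter n θ c δ p := Nat.le_ceil _
  -- The product is `1 / √8`; the weaker `1 / 4` already suffices.
  have hprod : 1 / 4 ≤ √(c * θ / (8 * m)) * √(m / (c * θ)) := by
    rw [← Real.sqrt_mul (by positivity)]
    refine Real.le_sqrt_of_sq_le ?_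
    have : c * θ / (8 * m) * (m / (c * θ)) = 1 / 8 := by
      rw [div_mul_div_comm, div_eq_div_iff (by positivity) (by positivity)]
      ring
    rw [this]; norm_num
  have hexp : L / 2 ≤ (2 * numIter n θ c δ p - 1) * √(m / (c * θ)) := by
    have h1 : 2 * (√(c * θ / (8 * m)) * L) ≤ 2 * numIter n θ c δ p - 1 := by linarith
    calc L / 2 = 2 * (1 / 4) * L := by ring
      _ ≤ 2 * (√(c * θ / (8 * m)) * √(m / (c * θ))) * L := by gcongr
      _ = 2 * (√(c * θ / (8 * m)) * L) * √(m / (c * θ)) := by ring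
      _ ≤ _ := by gcongr
  have hLexp : Real.exp (-(L / 2)) = p / (2 * √n) := by
    have hs : (2 * √n / p) ^ 2 = 4 * n / p ^ 2 := by
      rw [div_pow, mul_pow, Real.sq_sqrt hn0.le]; norm_num
    have hpos : 0 < 2 * √n / p := by positivity
    rw [hL, ← hs, Real.log_pow, Nat.cast_ofNat, mul_div_cancel_left₀ _ two_ne_zero, Real.exp_neg,
      Real.exp_log hpos, inv_div]
  calc _ ≤ 2 * Real.exp (-(L / 2)) := by gcongr
    _ = p / √n := by rw [hLexp]; ring

variable {A : Fin d → Matrix (Fin n) (Fin n) ℝ} {X : Matrix (Fin n) (Fin n) ℝ}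

theorem IsAlgOutput.valid (hA : ∀ i, (A i).PosSemidef) (hX : X ∈ feasible A) {θ c p δ : ℝ}
    {b : EuclideanSpace ℝ (Fin n)} (hb : ‖b‖ = 1) {out : Matrix (Fin n) (Fin n) ℝ × ℝ}
    (hout : IsAlgOutput θ c p (grad A X) δ X b out) :
    out.1 ∈ spectraplex n ∧ out.2 = linObj A X X - linObj A X out.1 ∧ 0 ≤ out.2 := by
  obtain ⟨u, hu, rfl⟩ := hout
  split_ifs with h
  · exact ⟨hX.1, by simp, le_rfl⟩
  · exact ⟨vecMulVec_self_mem_spectraplex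
      (hu.norm_eq_one (neg_grad_posSemidef hA hX).isHermitian hb), rfl, not_lt.1 h⟩

theorem isSymmetric_neg_grad (hA : ∀ i, (A i).PosSemidef) (hX : X ∈ feasible A) :
    (Matrix.toEuclideanLin (-grad A X)).IsSymmetric :=
  Matrix.isSymmetric_toEuclideanLin_iff.2 (neg_grad_posSemidef hA hX).isHermitian

/-- The algorithm succeeds unless the starting vector is almost orthogonal to the top eigenvector
of the negative gradient. -/
theorem IsAlgOutput.largeGap_or_isSubopt (hn : 1 ≤ n) (hd : 1 ≤ d) (hA : ∀ i, (A i).PosSemidef)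
    (hX : X ∈ feasible A) {c p δ : ℝ} (hc : 2 < c) (hp0 : 0 < p) (hp1 : p ≤ 1) (hδ : 0 < δ)
    {b : EuclideanSpace ℝ (Fin n)} (hb : ‖b‖ = 1) {out : Matrix (Fin n) (Fin n) ℝ × ℝ}
    (hout : IsAlgOutput (d : ℝ) c p (grad A X) δ X b out)
    (hgen : p / √n < |((isSymmetric_neg_grad hA hX).eigenvectorBasis
      finrank_euclideanSpace_fin).repr b ⟨0, hn⟩|) :
    LargeGap d 0 out.2 ∨ IsSubopt A X δ out.1 := by
  have hvalid := hout.valid hA hX hb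
  have hJ := (neg_grad_posSemidef hA hX).isHermitian
  set hT := isSymmetric_neg_grad hA hX
  set B := hT.eigenvectorBasis finrank_euclideanSpace_fin with hB
  set lam := hT.eigenvalues finrank_euclideanSpace_fin ⟨0, hn⟩ with hlam
  obtain ⟨u, hu, hout⟩ := hout
  set ξ := inner ℝ u (Matrix.toEuclideanLin (-grad A X) u) with hξ
  have hd0 : (0 : ℝ) < d := by exact_mod_cast hd
  have hm : 0 < min δ ((c - 2) * d) := lt_min hδ (mul_pos (by linarith) hd0)
  have hcd : 0 < c * d := mul_pos (by linarith) hd0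
  have hmax : ∀ z : EuclideanSpace ℝ (Fin n),
      inner ℝ z (Matrix.toEuclideanLin (-grad A X) z) ≤ lam * ‖z‖ ^ 2 :=
    inner_self_apply_le hT fun ν hν => by
      obtain ⟨i, hi⟩ := hT.exists_eigenvalues_eq finrank_euclideanSpace_fin hν
      rw [← show hT.eigenvalues finrank_euclideanSpace_fin i = ν by simpa using hi]
      exact hT.eigenvalues_antitone _ (Fin.mk_le_of_le_val (Nat.zero_le _))
  have hmin : ∀ K ∈ spectraplex n, -lam ≤ linObj A X K :=
    fun K hK => neg_le_minner_of_mem_spectraplex hJ hmax hK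
  have hlam_ge : (d : ℝ) ≤ lam := by
    have := hmin X hX.1
    rw [linObj_self hX] at this
    linarith
  have hlinu : linObj A X (Matrix.vecMulVec u u) = -ξ := minner_vecMulVec_self hJ u
  have hself : minner (grad A X) X = -d := linObj_self hX
  set ε := min δ ((c - 2) * d) / (c * d) with hε
  have hε0 : 0 < ε := div_pos hm hcd
  have hεcd : ε * (c * d) = min δ ((c - 2) * d) := div_mul_cancel₀ _ hcd.ne'
  have hε1 : ε < 1 := by
    rw [hε, div_lt_one hcd]
    exact (min_le_right _ _).trans_lt (by nlinarith)
  have hacc : (1 - ε) * lam < ξ := by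
    by_contra! hcon
    have h := abs_repr_le_of_krylov hT
      (fun i => (Matrix.isPositive_toEuclideanLin_iff.2
        (neg_grad_posSemidef hA hX)).nonneg_eigenvalues _ i)
      (one_le_numIter hn hp0 hp1 d c δ) hb ⟨0, hn⟩ (hd0.trans_le hlam_ge) hε0 hε1 hcon
      (fun q hq => hu.inner_aeval_le hJ hb q hq)
    exact absurd hgen (not_lt.2 (h.trans (two_mul_exp_numIter_le hn hp0 hp1 hm hcd)))
  rcases le_or_gt lam (c * d) with hsmall | hlarge
  · right
    have hgap : lam - δ ≤ ξ := by
      have : ε * lam ≤ δ :=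
        (mul_le_mul_of_nonneg_left hsmall hε0.le).trans (hεcd.le.trans (min_le_left _ _))
      linarith
    have hstar : linObj A X (Matrix.vecMulVec (B ⟨0, hn⟩) (B ⟨0, hn⟩)) = -lam := by
      rw [linObj, minner_vecMulVec_self hJ, hB, hT.apply_eigenvectorBasis, real_inner_smul_right,
        real_inner_self_eq_norm_sq, OrthonormalBasis.norm_eq_one]
      simp [hlam]
    refine ⟨hvalid.1, _, vecMulVec_self_mem_spectraplex (B.norm_eq_one ⟨0, hn⟩),
      fun K hK => hstar.le.trans (hmin K hK), ?_⟩
    rw [hstar]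
    -- The fallback to `X` happens only when `X` has the smaller linear objective, so it preserves
    -- suboptimality.
    have hle : linObj A X out.1 ≤ -ξ := by
      rw [hout]
      split_ifs with h
      · change minner (grad A X) X - linObj A X (Matrix.vecMulVec u u) < 0 at h
        rw [hlinu] at h
        change minner (grad A X) X ≤ -ξ
        linarith
      · exact hlinu.le
    linarith
  · left
    have hbig : 2 * d < ξ := by
      have h1 : (1 - ε) * (c * d) ≤ (1 - ε) * lam :=
        mul_le_mul_of_nonneg_left hlarge.le (by linarith)
      have h2 : ε * (c * d) ≤ (c - 2) * d := hεcd.le.trans (min_le_right _ _)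
      linarith
    have hgap : minner (grad A X) X - minner (grad A X) (Matrix.vecMulVec u u) = ξ - d := by
      rw [hself, show minner (grad A X) (Matrix.vecMulVec u u) = -ξ from hlinu]
      ring
    rw [hout, hgap, if_neg (by linarith)]
    change (d : ℝ) + 0 < ξ - d
    linarith

end Algorithm

end GMean

end

theorem lemma6p2 (n d : ℕ) (hn : 1 ≤ n) (hd : 1 ≤ d)
    (A : Fin d → Matrix (Fin n) (Fin n) ℝ) (hA : ∀ i, (A i).PosSemidef)
    (c p : ℝ) (hc : 2 < c) (hp0 : 0 < p) (hp1 : p ≤ 1) :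
    (∃ O, GMean.Realizes A c p O) ∧
      ∀ O, GMean.Realizes A c p O → GMean.IsPLMO A p (GMean.uniformSphere n) O := by
  constructor
  · choose O hO using fun D δ X b => GMean.exists_isAlgOutput hn hp0 hp1 (d : ℝ) c D δ X b
    exact ⟨fun D δ X b => O D δ X b, fun X _ δ _ b => hO _ _ _ _⟩
  · refine fun O hO => ⟨GMean.isProbabilityMeasure_uniformSphere hn, fun X hX δ hδ =>
      ⟨fun b => (hO X hX δ hδ b).valid hA hX (norm_eq_of_mem_sphere b), ?_⟩⟩
    have hn0 : (0 : ℝ) < n := by exact_mod_cast hn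
    -- The failure set need not be measurable, since the eigenvector choices in `O` are arbitrary;
    -- it lies in a band that depends on `X` alone.
    have hsub : {b | ¬ (GMean.LargeGap d 0 (O (GMean.grad A X) δ X b).2 ∨
        GMean.IsSubopt A X δ (O (GMean.grad A X) δ X b).1)} ⊆
        {b : Metric.sphere (0 : EuclideanSpace ℝ (Fin n)) 1 |
          |((GMean.isSymmetric_neg_grad hA hX).eigenvectorBasis finrank_euclideanSpace_fin).repr
            (b : EuclideanSpace ℝ (Fin n)) ⟨0, hn⟩| ≤ p / √n} := by
      intro b hb
      by_contra hgen
      exact hb ((hO X hX δ hδ b).largeGap_or_isSubopt hn hd hA hX hc hp0 hp1 hδ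
        (norm_eq_of_mem_sphere b) (not_le.1 hgen))
    refine (measure_mono hsub).trans
      ((GMean.uniformSphere_abs_repr_le _ _ (by positivity)).trans_eq ?_)
    rw [div_mul_cancel₀ _ (Real.sqrt_pos.2 hn0).ne']
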